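/- Let $S$ be a Polish space with its Borel $\sigma$-algebra and let $\xi=\{\xi_{ij}: i,j\in\mathbb N\}$ be an array of $S$-valued random variables on a probability space. Call $\xi$ row exchangeable if the arrays $\{\xi_{\sigma(i),\tau_i(j)}\}_{i,j}$ and $\{\xi_{ij}\}_{i,j}$ have the same finite-dimensional distributions for every finite permutation $\sigma$ of $\mathbb N$ and every family $(\tau_i)_{i\in\mathbb N}$ of finite permutations of $\mathbb N$, where a finite permutation is a bijection $\mathbb N\to\mathbb N$ that fixes all but finitely many numbers. Then $\xi$ is row exchangeable if and only if there exist a (Borel) measurable function $f:\mathbb R^3\to S$ and, on some probability space, an i.i.d. collection of random variables $\{\alpha,\beta_i,\lambda_{ij}: i,j\in\mathbb N\}$, uniformly distributed on $(0,1)$, such that the array $\{f(\alpha,\beta_i,\lambda_{ij})\}_{i,j}$ has the same finite-dimensional distributions as $\xi$. -/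

import Mathlib

open MeasureTheory ProbabilityTheory

universe u v w

/-- Two families of `S`-valued random variables, indexed by the same set but possibly living on
different probability spaces, have the same finite-dimensional distributions. -/
def SameFDD {T Ω Ω' S : Type*} [MeasurableSpace Ω] [MeasurableSpace Ω'] [MeasurableSpace S]
    (X : T → Ω → S) (P : Measure Ω) (Y : T → Ω' → S) (Q : Measure Ω') : Prop :=
  ∀ I : Finset T,
    IdentDistrib (fun ω (t : I) => X t ω) (fun ω (t : I) => Y t ω) P Q

/-- A (finite) permutation of `ℕ`: a bijection that fixes all but finitely many numbers. -/
def IsFinitePerm (σ : Equiv.Perm ℕ) : Prop :=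
  ∃ n₀ : ℕ, ∀ n ≥ n₀, σ n = n

/-- Row exchangeability of an array `ξ`: its finite-dimensional distributions do not change when
the rows are permuted among each other and, in addition, the entries of each row are permuted by
a permutation that may depend on the row. -/
def RowExchangeable {Ω S : Type*} [MeasurableSpace Ω] [MeasurableSpace S]
    (ξ : ℕ → ℕ → Ω → S) (P : Measure Ω) : Prop :=
  ∀ (σ : Equiv.Perm ℕ) (τ : ℕ → Equiv.Perm ℕ), IsFinitePerm σ → (∀ i, IsFinitePerm (τ i)) →
    SameFDD (fun p : ℕ × ℕ => ξ (σ p.1) (τ p.1 p.2)) P (fun p : ℕ × ℕ => ξ p.1 p.2) P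

/-- The `X k` are independent random variables, each uniformly distributed on `(0, 1)`. -/
def IsIIDUniform {κ Ω : Type*} [MeasurableSpace Ω] (X : κ → Ω → ℝ) (P : Measure Ω) : Prop :=
  (∀ k, Measurable (X k)) ∧
    (∀ k, pdf.IsUniform (X k) (Set.Ioo (0 : ℝ) 1) P volume) ∧
    iIndepFun X P

/-- The collection `{α, β i, lam i j : i, j ∈ ℕ}` as a single family, one index per variable. -/
def collect {Ω : Type*} (α : Ω → ℝ) (β : ℕ → Ω → ℝ) (lam : ℕ → ℕ → Ω → ℝ) :
    Unit ⊕ ℕ ⊕ (ℕ × ℕ) → Ω → ℝ :=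
  Sum.elim (fun _ => α) (Sum.elim β (fun p => lam p.1 p.2))

/-!
The idea is to condition on part of the array itself, which makes limit theorems unnecessary.

Split the cells of a row exchangeable array `ξ` in three: `A` collects the rows of odd index, `B i`
the odd entries of row `2 * i`, and `X (i, j) = ξ (2 * i) (2 * j)` is what remains. The joint law of
the entries at a family of cells depends only on which cells share a row and which coincide
(`RowExchangeable.map_eq`), so the pair consisting of `(A, B i)` and `X (i, j)` has the same law as
the pair in which `(A, B i)` is replaced by *all* cells other than `(2 * i, 2 * j)`, suitably
enumerated. When `(U, X)` and `(V, X)` have the same law and `U` is a function of `V`, the variables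
`κ(V)(C) = P(X ∈ C | V)` and `κ(U)(C) = P(X ∈ C | U)` have the same second moment, and the second is
a conditional expectation of the first, so they agree almost surely (`ae_kernel_apply_eq`). Hence
the conditional law of `X (i, j)` given all other cells is `η (A, B i)`, for a kernel `η` that does
not depend on `(i, j)`. In the same way the conditional law of `B i` given all other rows is `κ A`.

Integrating out one variable after another (`HasCondLaw.lintegral_prod`), the law of `A` and the
kernels `κ` and `η` determine the finite-dimensional laws of `X` (`measure_biInter_eq_lintegral`),
which are those of `ξ`. Representing the law of `A` and the two kernels as images of the uniform
law by measurable maps `g₀`, `g₁`, `g₂`, the array `f (α, β i, lam i j)` with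
`f (r, s, t) = g₂ ((g₀ r, g₁ (g₀ r, s)), t)` satisfies the same conditional law identities, hence has
the same finite-dimensional laws. The converse holds because permuting the indices of an i.i.d.
family does not change its law.
-/

open scoped ENNReal

/-! ### Conditional laws -/

section CondLaw

variable {Ω E F : Type*} [mΩ : MeasurableSpace Ω] [mE : MeasurableSpace E] [mF : MeasurableSpace F]

/-- The conditional law of `X` given the σ-algebra `m` is `κ (U ω)`. This is expressed by testing
against products of a nonnegative `m`-measurable function and a nonnegative function of `(U, X)`;
measurability of `U` with respect to `m` is not part of the definition. -/
def HasCondLaw (P : Measure Ω) (m : MeasurableSpace Ω) (X : Ω → F) (U : Ω → E)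
    (κ : Kernel E F) : Prop :=
  ∀ H : Ω → ℝ≥0∞, Measurable[m] H → ∀ φ : E × F → ℝ≥0∞, Measurable φ →
    ∫⁻ ω, H ω * φ (U ω, X ω) ∂P = ∫⁻ ω, H ω * ∫⁻ x, φ (U ω, x) ∂κ (U ω) ∂P

/-- Enlarging the information from `U` to `V` does not change the conditional law of `X` when
`(U, X)` and `(V, X)` have the same law. For `k = κ(·)(C)`, both `E[k(U)²]` and `E[k(V)²]` equal
`E[k(U) k(V)]`, so `E[(k(V) - k(U))²] = 0`. -/
theorem ae_kernel_apply_eq {P : Measure Ω} [IsProbabilityMeasure P] {U V : Ω → E} {X : Ω → F}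
    (hU : Measurable U) (hV : Measurable V) (hX : Measurable X) {κ : Kernel E F} [IsMarkovKernel κ]
    (hUκ : P.map (fun ω => (U ω, X ω)) = P.map U ⊗ₘ κ)
    (hUV : P.map (fun ω => (U ω, X ω)) = P.map (fun ω => (V ω, X ω)))
    {u : E → E} (hu : Measurable u) (huV : U = u ∘ V) {C : Set F} (hC : MeasurableSet C) :
    ∀ᵐ ω ∂P, κ (V ω) C = κ (U ω) C := by
  have hmap : P.map V = P.map U := by
    have := congrArg (Measure.map Prod.fst) hUV
    rw [Measure.map_map measurable_fst (hU.prodMk hX),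
      Measure.map_map measurable_fst (hV.prodMk hX)] at this
    exact this.symm
  have hVκ : P.map (fun ω => (V ω, X ω)) = P.map V ⊗ₘ κ := by rw [← hUV, hUκ, hmap]
  set k : E → ℝ := fun e => (κ e).real C with hk
  have hkm : Measurable k := (κ.measurable_coe hC).ennreal_toReal
  have hk0 : ∀ e, 0 ≤ k e := fun e => measureReal_nonneg
  have hk1 : ∀ e, k e ≤ 1 := fun e => measureReal_le_one
  have hbdd : ∀ f : Ω → ℝ, Measurable f → (∀ ω, 0 ≤ f ω) → (∀ ω, f ω ≤ 1) → Integrable f P := by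
    intro f hf h0 h1
    refine Integrable.of_bound hf.aestronglyMeasurable 1 (ae_of_all _ fun ω => ?_)
    rw [Real.norm_eq_abs, abs_of_nonneg (h0 ω)]
    exact h1 ω
  -- Integrating out `X` against a bounded function of `W`, for `W = U` and for `W = V`.
  have key : ∀ W : Ω → E, Measurable W → P.map (fun ω => (W ω, X ω)) = P.map W ⊗ₘ κ →
      ∀ h : E → ℝ, Measurable h → (∀ e, 0 ≤ h e) → (∀ e, h e ≤ 1) →
      ∫ ω, h (W ω) * C.indicator 1 (X ω) ∂P = ∫ ω, h (W ω) * k (W ω) ∂P := by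
    intro W hW hWκ h hh h0 h1
    have hm : Measurable fun p : E × F => h p.1 * C.indicator (1 : F → ℝ) p.2 :=
      (hh.comp measurable_fst).mul ((measurable_one.indicator hC).comp measurable_snd)
    have h2 : ∫ ω, h (W ω) * C.indicator 1 (X ω) ∂P
        = ∫ p, h p.1 * C.indicator 1 p.2 ∂(P.map fun ω => (W ω, X ω)) :=
      (integral_map (hW.prodMk hX).aemeasurable hm.aestronglyMeasurable).symm
    have : IsProbabilityMeasure (P.map W) := Measure.isProbabilityMeasure_map hW.aemeasurable
    rw [h2, hWκ, Measure.integral_compProd]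
    · rw [integral_map hW.aemeasurable]
      · refine integral_congr_ae (ae_of_all _ fun ω => ?_)
        simp only [integral_const_mul, hk]
        rw [integral_indicator_one hC]
      · refine (StronglyMeasurable.integral_kernel_prod_right' (κ := κ)
          hm.stronglyMeasurable).aestronglyMeasurable
    · refine Integrable.of_bound hm.aestronglyMeasurable 1 (ae_of_all _ fun p => ?_)
      by_cases hp : p.2 ∈ C <;> simp [hp, abs_of_nonneg (h0 p.1), h1 p.1]
  -- `k (U)` is also a function of `V`, so both laws may be tested against it.
  have hUU := key U hU hUκ k hkm hk0 hk1
  have hVU := key V hV hVκ (k ∘ u) (hkm.comp hu) (fun _ => hk0 _) fun _ => hk1 _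
  have hcomp : ∀ ω, (k ∘ u) (V ω) = k (U ω) := fun ω => by simp [huV]
  simp only [hcomp] at hVU
  have hsq : ∫ ω, k (V ω) * k (V ω) ∂P = ∫ ω, k (U ω) * k (U ω) ∂P := by
    rw [← integral_map (f := fun e => k e * k e) hV.aemeasurable
        (hkm.mul hkm).aestronglyMeasurable,
      ← integral_map (f := fun e => k e * k e) hU.aemeasurable
        (hkm.mul hkm).aestronglyMeasurable, hmap]
  have hint : ∀ W W' : Ω → E, Measurable W → Measurable W' →
      Integrable (fun ω => k (W ω) * k (W' ω)) P := fun W W' hW hW' =>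
    hbdd _ ((hkm.comp hW).mul (hkm.comp hW')) (fun _ => mul_nonneg (hk0 _) (hk0 _))
      fun _ => mul_le_one₀ (hk1 _) (hk0 _) (hk1 _)
  have hzero : ∫ ω, (k (V ω) - k (U ω)) ^ 2 ∂P = 0 := by
    have : ∀ ω, (k (V ω) - k (U ω)) ^ 2
        = k (V ω) * k (V ω) + k (U ω) * k (U ω) - 2 * (k (U ω) * k (V ω)) := fun ω => by ring
    simp only [this]
    rw [integral_sub ?_ ((hint U V hU hV).const_mul 2),
      integral_add (hint V V hV hV) (hint U U hU hU), integral_const_mul, hsq, ← hVU, hUU]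
    · ring
    · exact (hint V V hV hV).add (hint U U hU hU)
  have hintsq : Integrable (fun ω => (k (V ω) - k (U ω)) ^ 2) P := by
    refine hbdd _ (((hkm.comp hV).sub (hkm.comp hU)).pow_const 2) (fun _ => sq_nonneg _) fun ω => ?_
    nlinarith [hk0 (V ω), hk1 (V ω), hk0 (U ω), hk1 (U ω)]
  have hae := (integral_eq_zero_iff_of_nonneg (fun ω => sq_nonneg _) hintsq).1 hzero
  filter_upwards [hae] with ω hω
  have h3 : k (V ω) = k (U ω) := by
    have : (k (V ω) - k (U ω)) ^ 2 = 0 := hω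
    nlinarith [pow_eq_zero_iff (two_ne_zero) |>.1 this]
  exact (ENNReal.toReal_eq_toReal_iff' (measure_ne_top _ _) (measure_ne_top _ _)).1 h3

/-- If `(U, X)` and `(V, X)` have the same law, with `U` a function of `V`, the conditional law of
`X` given `U` is also the one given `V`. -/
theorem hasCondLaw_of_map_eq {P : Measure Ω} [IsProbabilityMeasure P] [StandardBorelSpace E]
    [Nonempty E] {U V : Ω → E} {X : Ω → F}
    (hU : Measurable[mE.comap V] U) (hV : Measurable V) (hX : Measurable X) {κ : Kernel E F}
    [IsMarkovKernel κ]
    (hUκ : P.map (fun ω => (U ω, X ω)) = P.map U ⊗ₘ κ)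
    (hUV : P.map (fun ω => (U ω, X ω)) = P.map (fun ω => (V ω, X ω))) :
    HasCondLaw P (mE.comap V) X U κ := by
  obtain ⟨u, hu, huV⟩ := hU.exists_eq_measurable_comp
  have hU' : Measurable U := huV ▸ hu.comp hV
  have hmap : P.map V = P.map U := by
    have := congrArg (Measure.map Prod.fst) hUV
    rw [Measure.map_map measurable_fst (hU'.prodMk hX),
      Measure.map_map measurable_fst (hV.prodMk hX)] at this
    exact this.symm
  have : IsProbabilityMeasure (P.map V) := Measure.isProbabilityMeasure_map hV.aemeasurable
  have hVX : P.map (fun ω => (V ω, X ω)) = P.map V ⊗ₘ κ.comap u hu := by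
    have : IsProbabilityMeasure (P.map fun ω => (V ω, X ω)) :=
      Measure.isProbabilityMeasure_map (hV.prodMk hX).aemeasurable
    refine Measure.ext_prod fun {T C} hT hC => ?_
    rw [← hUV, hUκ, ← hmap, Measure.compProd_apply_prod hT hC, Measure.compProd_apply_prod hT hC,
      setLIntegral_map hT (κ.measurable_coe hC) hV,
      setLIntegral_map hT ((κ.comap u hu).measurable_coe hC) hV]
    refine setLIntegral_congr_fun_ae (hV hT) ?_
    filter_upwards [ae_kernel_apply_eq hU' hV hX hUκ hUV hu huV hC] with ω hω _
    rw [hω, Kernel.comap_apply, huV, Function.comp_apply]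
  intro H hH φ hφ
  obtain ⟨h, hh, rfl⟩ := hH.exists_eq_measurable_comp
  have hm : Measurable fun p : E × F => h p.1 * φ (u p.1, p.2) := by fun_prop
  have hm' : Measurable fun e => h e * ∫⁻ x, φ (u e, x) ∂κ (u e) :=
    hh.mul ((Measurable.lintegral_kernel_prod_right' hφ).comp hu)
  calc ∫⁻ ω, (h ∘ V) ω * φ (U ω, X ω) ∂P
      = ∫⁻ p, h p.1 * φ (u p.1, p.2) ∂(P.map fun ω => (V ω, X ω)) := by
        rw [lintegral_map hm (hV.prodMk hX), huV]; rfl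
    _ = ∫⁻ e, h e * ∫⁻ x, φ (u e, x) ∂κ (u e) ∂(P.map V) := by
        rw [hVX, Measure.lintegral_compProd hm]
        refine lintegral_congr fun e => ?_
        simp only [Kernel.comap_apply]
        exact lintegral_const_mul _ (by fun_prop)
    _ = _ := by rw [lintegral_map hm' hV, huV]; rfl

/-- The `X c` are conditionally independent, with laws `κ (U c)`, given whatever belongs to all the
`m c`: since the other `X d` are `m c`-measurable, the `X c` can be integrated out one by one. -/
theorem HasCondLaw.lintegral_prod {ι : Type*} {P : Measure Ω} {m : ι → MeasurableSpace Ω}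
    {X : ι → Ω → F} {U : ι → Ω → E} {κ : Kernel E F} [IsMarkovKernel κ]
    (h : ∀ c, HasCondLaw P (m c) (X c) (U c) κ)
    (hX : ∀ c d, d ≠ c → Measurable[m c] (X d)) (hU : ∀ c d, Measurable[m c] (U d))
    {φ : ι → E × F → ℝ≥0∞} (hφ : ∀ c, Measurable (φ c)) (I : Finset ι) :
    ∀ G : Ω → ℝ≥0∞, (∀ c, Measurable[m c] G) →
    ∫⁻ ω, G ω * ∏ c ∈ I, φ c (U c ω, X c ω) ∂P
      = ∫⁻ ω, G ω * ∏ c ∈ I, ∫⁻ x, φ c (U c ω, x) ∂κ (U c ω) ∂P := by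
  classical
  induction I using Finset.induction_on with
  | empty => simp
  | insert c I hc ih =>
    intro G hG
    have hH : Measurable[m c] fun ω => G ω * ∏ d ∈ I, φ d (U d ω, X d ω) := by
      refine Measurable.fun_mul (hG c) ?_
      refine Finset.measurable_fun_prod _ fun d hd => ?_
      exact (hφ d).comp ((hU c d).prodMk (hX c d fun e => hc (e ▸ hd)))
    have hG' : ∀ d, Measurable[m d] fun ω => G ω * ∫⁻ x, φ c (U c ω, x) ∂κ (U c ω) := fun d =>
      Measurable.fun_mul (hG d)
        ((Measurable.lintegral_kernel_prod_right' (κ := κ) (hφ c)).comp (hU d c))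
    have h1 := h c _ hH (φ c) (hφ c)
    have h2 := ih _ hG'
    simp only [Finset.prod_insert hc]
    calc _ = ∫⁻ ω, (G ω * ∏ d ∈ I, φ d (U d ω, X d ω)) * φ c (U c ω, X c ω) ∂P :=
          lintegral_congr fun ω => by ring
      _ = ∫⁻ ω, (G ω * ∫⁻ x, φ c (U c ω, x) ∂κ (U c ω)) * ∏ d ∈ I, φ d (U d ω, X d ω) ∂P := by
          rw [h1]; exact lintegral_congr fun ω => by ring
      _ = _ := by rw [h2]; exact lintegral_congr fun ω => by ring

/-- A variable `g (U, L)` whose noise `L` is independent of `Z`, with `U` a function of `Z`, has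
conditional law given `Z` the law of `g (u, L)` evaluated at `u = U`. -/
theorem hasCondLaw_of_indepFun {G : Type*} [mG : MeasurableSpace G] {P : Measure Ω}
    [IsProbabilityMeasure P] {Z : Ω → G} {L : Ω → ℝ} (hZ : Measurable Z) (hL : Measurable L)
    (hZL : IndepFun Z L P) {U : Ω → E} (hU : Measurable[mG.comap Z] U)
    {g : E × ℝ → F} (hg : Measurable g) {κ : Kernel E F}
    (hκ : ∀ e, (P.map L).map (fun r => g (e, r)) = κ e) :
    HasCondLaw P (mG.comap Z) (fun ω => g (U ω, L ω)) U κ := by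
  intro H hH φ hφ
  have hHU : Measurable[mG.comap Z] fun ω => (H ω, U ω) := Measurable.prodMk hH hU
  have hHU' : Measurable fun ω => (H ω, U ω) := hHU.mono hZ.comap_le le_rfl
  have hI : IndepFun (fun ω => (H ω, U ω)) L P := indep_of_indep_of_le_left hZL hHU.comap_le
  have hmap := (indepFun_iff_map_prod_eq_prod_map_map hHU'.aemeasurable hL.aemeasurable).1 hI
  have : IsProbabilityMeasure (P.map L) := Measure.isProbabilityMeasure_map hL.aemeasurable
  have h1 : Measurable fun p : (ℝ≥0∞ × E) × ℝ => p.1.1 * φ (p.1.2, g (p.1.2, p.2)) := by fun_prop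
  have h2 : ∀ e, ∫⁻ r, φ (e, g (e, r)) ∂(P.map L) = ∫⁻ x, φ (e, x) ∂κ e := fun e => by
    rw [← hκ]
    have h3 : Measurable fun x => φ (e, x) := by fun_prop
    have h4 : Measurable fun r => g (e, r) := by fun_prop
    exact (lintegral_map h3 h4).symm
  calc ∫⁻ ω, H ω * φ (U ω, g (U ω, L ω)) ∂P
      = ∫⁻ p, p.1.1 * φ (p.1.2, g (p.1.2, p.2)) ∂(P.map fun ω => ((H ω, U ω), L ω)) :=
        (lintegral_map h1 (hHU'.prodMk hL)).symm
    _ = ∫⁻ q, q.1 * ∫⁻ r, φ (q.2, g (q.2, r)) ∂(P.map L) ∂(P.map fun ω => (H ω, U ω)) := by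
        rw [hmap, lintegral_prod _ h1.aemeasurable]
        refine lintegral_congr fun q => ?_
        have h3 : Measurable fun r => φ (q.2, g (q.2, r)) := by fun_prop
        exact lintegral_const_mul q.1 h3
    _ = _ := by
        have h3 : Measurable fun p : E × ℝ => φ (p.1, g p) := by fun_prop
        have h4 : Measurable fun e => ∫⁻ r, φ (e, g (e, r)) ∂(P.map L) := h3.lintegral_prod_right'
        rw [lintegral_map (by fun_prop) hHU']
        simp only [h2]

end CondLaw

/-! ### Invariance of joint laws -/

section Invariance

/-- A partial injection `a t ↦ b t` with finite domain extends to a finite permutation. -/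
theorem exists_isFinitePerm_apply_eq {T : Type*} (I : Finset T) (a b : T → ℕ)
    (h : ∀ s ∈ I, ∀ t ∈ I, a s = a t ↔ b s = b t) :
    ∃ σ : Equiv.Perm ℕ, IsFinitePerm σ ∧ ∀ t ∈ I, σ (a t) = b t := by
  classical
  induction I using Finset.induction_on with
  | empty => exact ⟨1, ⟨0, fun _ _ => rfl⟩, by simp⟩
  | insert t I ht ih =>
    obtain ⟨σ, ⟨N, hN⟩, hσ⟩ := ih fun s hs t ht =>
      h s (Finset.mem_insert_of_mem hs) t (Finset.mem_insert_of_mem ht)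
    by_cases hex : ∃ s ∈ I, a s = a t
    · obtain ⟨s, hs, hst⟩ := hex
      refine ⟨σ, ⟨N, hN⟩, fun r hr => ?_⟩
      rcases Finset.mem_insert.1 hr with rfl | hr
      · rw [← hst, hσ s hs]
        exact (h s (Finset.mem_insert_of_mem hs) r (Finset.mem_insert_self _ _)).1 hst
      · exact hσ r hr
    · push Not at hex
      -- The transposition corrects the value at `a t`; it moves no value prescribed before.
      refine ⟨Equiv.swap (σ (a t)) (b t) * σ, ⟨max N (max (σ (a t) + 1) (b t + 1)), ?_⟩, ?_⟩
      · intro n hn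
        simp only [ge_iff_le, max_le_iff] at hn
        rw [Equiv.Perm.mul_apply, hN n hn.1, Equiv.swap_apply_of_ne_of_ne] <;> omega
      · intro r hr
        rcases Finset.mem_insert.1 hr with rfl | hr
        · simp
        · rw [Equiv.Perm.mul_apply, Equiv.swap_apply_of_ne_of_ne, hσ r hr]
          · exact fun hr' => hex r hr (σ.injective hr')
          · rw [hσ r hr]
            exact fun hr' => hex r hr ((h r (Finset.mem_insert_of_mem hr) t
              (Finset.mem_insert_self _ _)).2 hr')

/-- The joint law of the entries of a row exchangeable array at a family of cells depends only on
which of the cells lie in the same row and which of them coincide. -/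
theorem RowExchangeable.map_eq {Ω S T : Type*} [MeasurableSpace Ω] [MeasurableSpace S]
    {P : Measure Ω} [IsProbabilityMeasure P] {ξ : ℕ → ℕ → Ω → S} (h : RowExchangeable ξ P)
    (hξ : ∀ i j, Measurable (ξ i j)) (p q : T → ℕ × ℕ)
    (hrow : ∀ s t, (p s).1 = (p t).1 ↔ (q s).1 = (q t).1) (hcell : ∀ s t, p s = p t ↔ q s = q t) :
    P.map (fun ω t => ξ (p t).1 (p t).2 ω) = P.map (fun ω t => ξ (q t).1 (q t).2 ω) := by
  classical
  have hm : ∀ r : T → ℕ × ℕ, Measurable fun ω t => ξ (r t).1 (r t).2 ω := fun r =>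
    measurable_pi_lambda _ fun t => hξ _ _
  refine (map_eq_iff_forall_finset_map_restrict_eq
    (X := fun t => ξ (p t).1 (p t).2) (Y := fun t => ξ (q t).1 (q t).2)
    (hm p).aemeasurable (hm q).aemeasurable).2 fun I => ?_
  obtain ⟨σ, hσf, hσ⟩ := exists_isFinitePerm_apply_eq I (fun t => (p t).1) (fun t => (q t).1)
    fun s _ t _ => hrow s t
  -- The permutation of row `n` only has to move the cells of the family lying in that row.
  have hτ : ∀ n, ∃ τ : Equiv.Perm ℕ, IsFinitePerm τ ∧
      ∀ t ∈ I.filter (fun t => (p t).1 = n), τ (p t).2 = (q t).2 := fun n => by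
    refine exists_isFinitePerm_apply_eq _ (fun t => (p t).2) (fun t => (q t).2) fun s hs t ht => ?_
    have hpe : (p s).1 = (p t).1 := (Finset.mem_filter.1 hs).2.trans (Finset.mem_filter.1 ht).2.symm
    have hqe := (hrow s t).1 hpe
    have := hcell s t
    simpa [Prod.ext_iff, hpe, hqe] using this
  choose τ hτf hτ using hτ
  have hid := (h σ τ hσf hτf (I.image p)).comp
    (u := fun x (t : I) => x ⟨p t, Finset.mem_image_of_mem p t.2⟩) (by fun_prop)
  have hL : (fun ω (t : I) => ξ (q t).1 (q t).2 ω) =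
      (fun x (t : I) => x ⟨p t, Finset.mem_image_of_mem p t.2⟩) ∘
        fun ω (c : (I.image p : Finset _)) => ξ (σ c.1.1) (τ c.1.1 c.1.2) ω := by
    funext ω t
    simp only [Function.comp_apply]
    rw [hσ t t.2, hτ _ t (Finset.mem_filter.2 ⟨t.2, rfl⟩)]
  rw [← hL] at hid
  exact hid.map_eq.symm

/-- Finite-dimensional laws are determined by the probabilities of boxes. -/
theorem sameFDD_of_measure_biInter_eq {T Ω Ω' S : Type*} [MeasurableSpace Ω] [MeasurableSpace Ω']
    [MeasurableSpace S] {P : Measure Ω} [IsProbabilityMeasure P] {Q : Measure Ω'}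
    [IsProbabilityMeasure Q] {X : T → Ω → S} {Y : T → Ω' → S} (hX : ∀ t, Measurable (X t))
    (hY : ∀ t, Measurable (Y t))
    (h : ∀ (I : Finset T) (C : T → Set S), (∀ t, MeasurableSet (C t)) →
      P (⋂ t ∈ I, X t ⁻¹' C t) = Q (⋂ t ∈ I, Y t ⁻¹' C t)) :
    SameFDD X P Y Q := by
  classical
  intro I
  have hXm : Measurable fun ω (t : I) => X t ω := measurable_pi_lambda _ fun t => hX t
  have hYm : Measurable fun ω (t : I) => Y t ω := measurable_pi_lambda _ fun t => hY t
  refine ⟨hXm.aemeasurable, hYm.aemeasurable, ?_⟩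
  have := Measure.isProbabilityMeasure_map (μ := P) hXm.aemeasurable
  have := Measure.isProbabilityMeasure_map (μ := Q) hYm.aemeasurable
  refine ext_of_generate_finite _ generateFrom_pi.symm isPiSystem_pi ?_ (by simp)
  rintro _ ⟨C, hC, rfl⟩
  have hC' : ∀ t : I, MeasurableSet (C t) := fun t => hC t (Set.mem_univ _)
  have hpi := MeasurableSet.univ_pi hC'
  rw [Measure.map_apply hXm hpi, Measure.map_apply hYm hpi]
  have key := h I (fun t => if ht : t ∈ I then C ⟨t, ht⟩ else Set.univ) fun t => by
    split_ifs with ht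
    exacts [hC' _, MeasurableSet.univ]
  convert key using 2
  · ext ω
    simp only [Set.mem_preimage, Set.mem_univ_pi, Set.mem_iInter, Subtype.forall]
    exact forall₂_congr fun t ht => by simp [ht]
  · ext ω
    simp only [Set.mem_preimage, Set.mem_univ_pi, Set.mem_iInter, Subtype.forall]
    exact forall₂_congr fun t ht => by simp [ht]

end Invariance

/-! ### Two-level mixtures -/

section TwoLevel

variable {Ω E F S : Type*} [MeasurableSpace Ω] [MeasurableSpace E] [MeasurableSpace F]
  [MeasurableSpace S]

/-- The finite-dimensional laws of an array `X` whose rows are, given `A`, labelled by independent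
`B i` of law `κ A`, and whose entries are, given `A` and all `B i`, independent of law
`η (A, B i)`. The σ-algebras `mB i` and `mX c` carry what `B i` and `X c` are conditioned on. -/
theorem measure_biInter_eq_lintegral {P : Measure Ω} {A : Ω → E} {B : ℕ → Ω → F}
    {X : ℕ × ℕ → Ω → S} {κ : Kernel E F} [IsMarkovKernel κ] {η : Kernel (E × F) S}
    [IsMarkovKernel η] (hA : Measurable A) (hX : ∀ c, Measurable (X c))
    {mB : ℕ → MeasurableSpace Ω} {mX : ℕ × ℕ → MeasurableSpace Ω}
    (hBlaw : ∀ i, HasCondLaw P (mB i) (B i) A κ) (hmB : ∀ i i', i' ≠ i → Measurable[mB i] (B i'))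
    (hmA : ∀ i, Measurable[mB i] A)
    (hXlaw : ∀ c, HasCondLaw P (mX c) (X c) (fun ω => (A ω, B c.1 ω)) η)
    (hmX : ∀ c d, d ≠ c → Measurable[mX c] (X d))
    (hmAB : ∀ c d : ℕ × ℕ, Measurable[mX c] fun ω => (A ω, B d.1 ω))
    (I : Finset (ℕ × ℕ)) {C : ℕ × ℕ → Set S} (hC : ∀ c, MeasurableSet (C c)) :
    P (⋂ c ∈ I, X c ⁻¹' C c) =
      ∫⁻ a, ∏ i ∈ I.image Prod.fst, ∫⁻ b, ∏ c ∈ I with c.1 = i, η (a, b) (C c) ∂κ a ∂P.map A := by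
  classical
  have hψ : ∀ i, Measurable fun e : E × F => ∏ c ∈ I with c.1 = i, η e (C c) := fun i =>
    Finset.measurable_fun_prod _ fun c _ => η.measurable_coe (hC c)
  have hφ : ∀ c, Measurable fun p : (E × F) × S => (C c).indicator (1 : S → ℝ≥0∞) p.2 := fun c =>
    (measurable_one.indicator (hC c)).comp measurable_snd
  have h1 := HasCondLaw.lintegral_prod hXlaw hmX hmAB hφ I (fun _ => 1) fun _ => measurable_const
  have h2 := HasCondLaw.lintegral_prod hBlaw hmB (fun i _ => hmA i) hψ (I.image Prod.fst)
    (fun _ => 1) fun _ => measurable_const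
  simp only [one_mul] at h1 h2
  calc P (⋂ c ∈ I, X c ⁻¹' C c)
      = ∫⁻ ω, ∏ c ∈ I, (C c).indicator 1 (X c ω) ∂P := by
        rw [← lintegral_indicator_one (Finset.measurableSet_biInter I fun c _ => hX c (hC c))]
        refine lintegral_congr fun ω => ?_
        simp only [Set.indicator_apply, Pi.one_apply, Finset.prod_ite_zero, Finset.prod_const_one]
        simp
    _ = ∫⁻ ω, ∏ c ∈ I, η (A ω, B c.1 ω) (C c) ∂P := by
        rw [h1]
        refine lintegral_congr fun ω => Finset.prod_congr rfl fun c _ => ?_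
        rw [lintegral_indicator_one (hC c)]
    _ = ∫⁻ ω, ∏ i ∈ I.image Prod.fst, ∏ c ∈ I with c.1 = i, η (A ω, B i ω) (C c) ∂P := by
        refine lintegral_congr fun ω => ?_
        rw [← Finset.prod_fiberwise_of_maps_to (t := I.image Prod.fst) (g := Prod.fst)
          fun c hc => Finset.mem_image_of_mem _ hc]
        refine Finset.prod_congr rfl fun i _ => Finset.prod_congr rfl fun c hc => ?_
        rw [(Finset.mem_filter.1 hc).2]
    _ = _ := by
        rw [h2, lintegral_map _ hA]
        exact Finset.measurable_fun_prod _ fun i _ =>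
          Measurable.lintegral_kernel_prod_right' (κ := κ) (hψ i)

end TwoLevel

/-! ### The mixture behind a row exchangeable array -/

section Extraction

/-- `measurable_pi_lambda` for a σ-algebra on the domain that is not the instance. -/
theorem measurable_pi_of_forall {Ω T S : Type*} [MeasurableSpace S] {m : MeasurableSpace Ω}
    {f : Ω → T → S} (h : ∀ t, Measurable[m] fun ω => f ω t) : Measurable[m] f :=
  measurable_pi_lambda f h

/-- The increasing enumeration of the natural numbers other than `m`. -/
def skip (m k : ℕ) : ℕ := if k < m then k else k + 1

theorem skip_ne (m k : ℕ) : skip m k ≠ m := by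
  unfold skip; split_ifs <;> omega

theorem skip_inj {m k l : ℕ} : skip m k = skip m l ↔ k = l := by
  unfold skip; split_ifs <;> omega

theorem exists_skip_eq {m n : ℕ} (h : n ≠ m) : ∃ k, skip m k = n := by
  rcases lt_or_gt_of_ne h with h | h
  · exact ⟨n, if_pos h⟩
  · exact ⟨n - 1, by unfold skip; split_ifs <;> omega⟩

/-- A disintegration of the common law of several pairs `(U, X)` serves all of them. -/
theorem map_prodMk_eq_compProd_condKernel {Ω E F : Type*} [MeasurableSpace Ω] [MeasurableSpace E]
    [MeasurableSpace F] [StandardBorelSpace F] [Nonempty F] {P : Measure Ω} {U : Ω → E} {X : Ω → F}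
    (hX : Measurable X) {ρ : Measure (E × F)} [IsFiniteMeasure ρ]
    (h : P.map (fun ω => (U ω, X ω)) = ρ) :
    P.map (fun ω => (U ω, X ω)) = P.map U ⊗ₘ ρ.condKernel := by
  have hU : P.map U = ρ.fst := by rw [← h, Measure.fst_map_prodMk hX]
  rw [h, hU, ρ.disintegrate ρ.condKernel]

theorem RowExchangeable.map_comp_eq {Ω S T G : Type*} [MeasurableSpace Ω] [MeasurableSpace S]
    [MeasurableSpace G] {P : Measure Ω} [IsProbabilityMeasure P] {ξ : ℕ → ℕ → Ω → S}
    (h : RowExchangeable ξ P) (hξ : ∀ i j, Measurable (ξ i j)) (p q : T → ℕ × ℕ)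
    (hrow : ∀ s t, (p s).1 = (p t).1 ↔ (q s).1 = (q t).1) (hcell : ∀ s t, p s = p t ↔ q s = q t)
    {g : (T → S) → G} (hg : Measurable g) :
    P.map (fun ω => g fun t => ξ (p t).1 (p t).2 ω)
      = P.map (fun ω => g fun t => ξ (q t).1 (q t).2 ω) := by
  have hm : ∀ r : T → ℕ × ℕ, Measurable fun ω t => ξ (r t).1 (r t).2 ω := fun r =>
    measurable_pi_of_forall fun t => hξ _ _
  have := congrArg (Measure.map g) (h.map_eq hξ p q hrow hcell)
  rwa [Measure.map_map hg (hm p), Measure.map_map hg (hm q)] at this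

/-- The entries of a row exchangeable array with both indices even have the law of a two-level
mixture, with the odd rows and the odd entries of the even rows as mixing variables; and they have
the law of the whole array. -/
theorem RowExchangeable.exists_kernel {Ω S : Type*} [MeasurableSpace Ω] [MeasurableSpace S]
    [StandardBorelSpace S] {P : Measure Ω} [IsProbabilityMeasure P] {ξ : ℕ → ℕ → Ω → S}
    (h : RowExchangeable ξ P) (hξ : ∀ i j, Measurable (ξ i j)) :
    ∃ (μ : Measure (ℕ × ℕ → S)) (κ : Kernel (ℕ × ℕ → S) (ℕ → S))
      (η : Kernel ((ℕ × ℕ → S) × (ℕ → S)) S),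
      IsProbabilityMeasure μ ∧ IsMarkovKernel κ ∧ IsMarkovKernel η ∧
      ∀ (I : Finset (ℕ × ℕ)) (C : ℕ × ℕ → Set S), (∀ c, MeasurableSet (C c)) →
        P (⋂ c ∈ I, ξ c.1 c.2 ⁻¹' C c) =
          ∫⁻ a, ∏ i ∈ I.image Prod.fst, ∫⁻ b, ∏ c ∈ I with c.1 = i, η (a, b) (C c) ∂κ a ∂μ := by
  classical
  obtain ⟨ω₀⟩ : Nonempty Ω := P.nonempty_of_neZero
  have : Nonempty S := ⟨ξ 0 0 ω₀⟩
  let A : Ω → ℕ × ℕ → S := fun ω c => ξ (2 * c.1 + 1) c.2 ω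
  let B : ℕ → Ω → ℕ → S := fun i ω l => ξ (2 * i) (2 * l + 1) ω
  let X : ℕ × ℕ → Ω → S := fun c => ξ (2 * c.1) (2 * c.2)
  -- All rows other than `2 * i`, and all cells other than `(2 * c.1, 2 * c.2)`.
  let VB : ℕ → Ω → ℕ × ℕ → S := fun i ω c => ξ (skip (2 * i) c.1) c.2 ω
  let VX : ℕ × ℕ → Ω → (ℕ × ℕ → S) × (ℕ → S) := fun c ω =>
    (VB c.1 ω, fun l => ξ (2 * c.1) (skip (2 * c.2) l) ω)
  have hA : Measurable A := measurable_pi_of_forall fun c => hξ _ _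
  have hB : ∀ i, Measurable (B i) := fun i => measurable_pi_of_forall fun l => hξ _ _
  have hX : ∀ c, Measurable (X c) := fun c => hξ _ _
  have hVB : ∀ i, Measurable (VB i) := fun i => measurable_pi_of_forall fun c => hξ _ _
  have hVX : ∀ c, Measurable (VX c) := fun c =>
    (hVB c.1).prodMk (measurable_pi_of_forall fun l => hξ _ _)
  -- What the conditioning σ-algebras contain.
  have hVBξ : ∀ i a b, a ≠ 2 * i → Measurable[MeasurableSpace.comap (VB i) inferInstance] (ξ a b) :=
    fun i a b hab => by
      obtain ⟨k, rfl⟩ := exists_skip_eq hab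
      exact (measurable_pi_apply (k, b)).comp (comap_measurable (VB i))
  have hVXξ : ∀ c a b, (a, b) ≠ (2 * c.1, 2 * c.2) →
      Measurable[MeasurableSpace.comap (VX c) inferInstance] (ξ a b) := fun c a b hab => by
    by_cases ha : a = 2 * c.1
    · subst ha
      obtain ⟨k, rfl⟩ := exists_skip_eq (m := 2 * c.2) (n := b) (by simpa using hab)
      exact ((measurable_pi_apply k).comp measurable_snd).comp (comap_measurable (VX c))
    · obtain ⟨k, rfl⟩ := exists_skip_eq ha
      exact ((measurable_pi_apply (k, b)).comp measurable_fst).comp (comap_measurable (VX c))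
  have hVXA : ∀ c d : ℕ × ℕ, Measurable[MeasurableSpace.comap (VX c) inferInstance]
      fun ω => (A ω, B d.1 ω) := fun c d => by
    refine Measurable.prodMk (measurable_pi_of_forall fun k => hVXξ _ _ _ ?_)
      (measurable_pi_of_forall fun k => hVXξ _ _ _ ?_) <;> simp only [ne_eq, Prod.mk.injEq] <;> omega
  -- The conditional law of the row variables.
  let gB : ((ℕ × ℕ) ⊕ ℕ → S) → (ℕ × ℕ → S) × (ℕ → S) := fun x =>
    (fun c => x (Sum.inl c), fun l => x (Sum.inr l))
  have hgB : Measurable gB := by fun_prop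
  let pB : ℕ → (ℕ × ℕ) ⊕ ℕ → ℕ × ℕ := fun i =>
    Sum.elim (fun c => (2 * c.1 + 1, c.2)) fun l => (2 * i, 2 * l + 1)
  let qB : ℕ → (ℕ × ℕ) ⊕ ℕ → ℕ × ℕ := fun i =>
    Sum.elim (fun c => (skip (2 * i) c.1, c.2)) fun l => (2 * i, 2 * l + 1)
  have hpB : ∀ i, P.map (fun ω => (A ω, B i ω)) = P.map fun ω => (A ω, B 0 ω) := fun i => by
    refine h.map_comp_eq hξ (pB i) (pB 0) ?_ ?_ hgB <;> rintro (s | s) (t | t) <;>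
      simp only [pB, Sum.elim_inl, Sum.elim_inr, Prod.mk.injEq] <;> omega
  have hqB : ∀ i, P.map (fun ω => (A ω, B i ω)) = P.map fun ω => (VB i ω, B i ω) := fun i => by
    refine h.map_comp_eq hξ (pB i) (qB i) ?_ ?_ hgB <;> rintro (s | s) (t | t) <;>
      simp only [pB, qB, Sum.elim_inl, Sum.elim_inr, Prod.mk.injEq, skip_inj, skip_ne,
        (skip_ne _ _).symm] <;> grind
  have : IsProbabilityMeasure (P.map fun ω => (A ω, B 0 ω)) :=
    Measure.isProbabilityMeasure_map (hA.prodMk (hB 0)).aemeasurable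
  have hBlaw : ∀ i, HasCondLaw P (MeasurableSpace.comap (VB i) inferInstance) (B i) A
      (P.map fun ω => (A ω, B 0 ω)).condKernel := fun i =>
    hasCondLaw_of_map_eq (measurable_pi_of_forall fun c => hVBξ i _ _ (by omega)) (hVB i) (hB i)
      (map_prodMk_eq_compProd_condKernel (hB i) (hpB i)) (hqB i)
  -- The conditional law of the entries.
  let gX : ((ℕ × ℕ) ⊕ ℕ ⊕ Unit → S) → ((ℕ × ℕ → S) × (ℕ → S)) × S := fun x =>
    ((fun c => x (Sum.inl c), fun l => x (Sum.inr (Sum.inl l))), x (Sum.inr (Sum.inr ())))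
  have hgX : Measurable gX := by fun_prop
  let pX : ℕ × ℕ → (ℕ × ℕ) ⊕ ℕ ⊕ Unit → ℕ × ℕ := fun c =>
    Sum.elim (fun d => (2 * d.1 + 1, d.2))
      (Sum.elim (fun l => (2 * c.1, 2 * l + 1)) fun _ => (2 * c.1, 2 * c.2))
  let qX : ℕ × ℕ → (ℕ × ℕ) ⊕ ℕ ⊕ Unit → ℕ × ℕ := fun c =>
    Sum.elim (fun d => (skip (2 * c.1) d.1, d.2))
      (Sum.elim (fun l => (2 * c.1, skip (2 * c.2) l)) fun _ => (2 * c.1, 2 * c.2))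
  have hpX : ∀ c, P.map (fun ω => ((A ω, B c.1 ω), X c ω))
      = P.map fun ω => ((A ω, B 0 ω), X (0, 0) ω) := fun c => by
    refine h.map_comp_eq hξ (pX c) (pX (0, 0)) ?_ ?_ hgX <;> rintro (s | s | s) (t | t | t) <;>
      simp only [pX, Sum.elim_inl, Sum.elim_inr, Prod.mk.injEq] <;> omega
  have hqX : ∀ c, P.map (fun ω => ((A ω, B c.1 ω), X c ω))
      = P.map fun ω => (VX c ω, X c ω) := fun c => by
    refine h.map_comp_eq hξ (pX c) (qX c) ?_ ?_ hgX <;> rintro (s | s | s) (t | t | t) <;>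
      simp only [pX, qX, Sum.elim_inl, Sum.elim_inr, Prod.mk.injEq, skip_inj, skip_ne,
        (skip_ne _ _).symm] <;> grind
  have : IsProbabilityMeasure (P.map fun ω => ((A ω, B 0 ω), X (0, 0) ω)) :=
    Measure.isProbabilityMeasure_map ((hA.prodMk (hB 0)).prodMk (hX _)).aemeasurable
  have hXlaw : ∀ c, HasCondLaw P (MeasurableSpace.comap (VX c) inferInstance) (X c)
      (fun ω => (A ω, B c.1 ω)) (P.map fun ω => ((A ω, B 0 ω), X (0, 0) ω)).condKernel := fun c =>
    hasCondLaw_of_map_eq (hVXA c c) (hVX c) (hX c)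
      (map_prodMk_eq_compProd_condKernel (hX c) (hpX c)) (hqX c)
  refine ⟨P.map A, (P.map fun ω => (A ω, B 0 ω)).condKernel,
    (P.map fun ω => ((A ω, B 0 ω), X (0, 0) ω)).condKernel,
    Measure.isProbabilityMeasure_map hA.aemeasurable, inferInstance, inferInstance, fun I C hC => ?_⟩
  rw [← measure_biInter_eq_lintegral hA hX hBlaw
    (fun i i' hi => measurable_pi_of_forall fun l => hVBξ i _ _ (by omega))
    (fun i => measurable_pi_of_forall fun c => hVBξ i _ _ (by omega)) hXlaw
    (fun c d hd => hVXξ c _ _ fun he => hd ?_) hVXA I hC]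
  · -- The array of even entries has the law of the whole array.
    have hfull := h.map_eq hξ (fun c : ℕ × ℕ => c) (fun c => (2 * c.1, 2 * c.2))
      (fun s t => by simp) fun s t => by simp [Prod.ext_iff]
    have hbox : MeasurableSet (⋂ c ∈ I, (fun x : ℕ × ℕ → S => x c) ⁻¹' C c) :=
      Finset.measurableSet_biInter I fun c _ => measurable_pi_apply c (hC c)
    have := congrArg (fun ν => ν (⋂ c ∈ I, (fun x : ℕ × ℕ → S => x c) ⁻¹' C c)) hfull
    rw [Measure.map_apply (measurable_pi_of_forall fun c => hξ _ _) hbox,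
      Measure.map_apply (measurable_pi_of_forall fun c => hξ _ _) hbox] at this
    simp only [Set.preimage_iInter] at this
    exact this
  · simp only [Prod.mk.injEq] at he
    exact Prod.ext (by omega) (by omega)

end Extraction

/-! ### Arrays built from uniform variables -/

section Model

theorem map_projIcc_cond_Ioo :
    (ProbabilityTheory.cond volume (Set.Ioo (0 : ℝ) 1)).map (Set.projIcc (0 : ℝ) 1 zero_le_one)
      = (volume : Measure unitInterval) := by
  have h1 : ProbabilityTheory.cond volume (Set.Ioo (0 : ℝ) 1) = (volume : Measure unitInterval).map Subtype.val := by
    rw [unitInterval.measurePreserving_coe.map_eq, ProbabilityTheory.cond, Real.volume_Ioo]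
    simp [Measure.restrict_congr_set Ioo_ae_eq_Icc, unitInterval]
  have hm : Measurable (Set.projIcc (0 : ℝ) 1 zero_le_one) := continuous_projIcc.measurable
  rw [h1, Measure.map_map hm measurable_subtype_coe]
  convert Measure.map_id
  funext x
  exact Set.projIcc_val zero_le_one x

/-- A Markov kernel into a standard Borel space is the image of the uniform law on `(0, 1)` by a
jointly measurable map; the noise is projected to `[0, 1]`, where Mathlib has this result. -/
theorem exists_measurable_map_cond_Ioo_eq {X Y : Type*} [MeasurableSpace X] [MeasurableSpace Y]
    [StandardBorelSpace Y] [Nonempty Y] (κ : Kernel X Y) [IsMarkovKernel κ] :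
    ∃ g : X × ℝ → Y, Measurable g ∧
      ∀ a, (ProbabilityTheory.cond volume (Set.Ioo (0 : ℝ) 1)).map (fun r => g (a, r)) = κ a := by
  obtain ⟨f, hf, hfκ⟩ := Kernel.exists_measurable_map_eq_unitInterval κ
  have hm : Measurable (Set.projIcc (0 : ℝ) 1 zero_le_one) := continuous_projIcc.measurable
  refine ⟨fun p => f p.1 (Set.projIcc (0 : ℝ) 1 zero_le_one p.2),
    hf.comp (measurable_fst.prodMk (hm.comp measurable_snd)), fun a => ?_⟩
  rw [← hfκ a, ← map_projIcc_cond_Ioo, Measure.map_map (by fun_prop) hm]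
  rfl

instance : IsProbabilityMeasure (ProbabilityTheory.cond volume (Set.Ioo (0 : ℝ) 1)) :=
  cond_isProbabilityMeasure_of_finite (by simp) (by simp)

/-- The `ULift` places the product space in an arbitrary universe. -/
theorem exists_isIIDUniform (ι : Type) :
    ∃ (Ω : Type w) (_ : MeasurableSpace Ω) (Q : Measure Ω) (X : ι → Ω → ℝ),
      IsProbabilityMeasure Q ∧ IsIIDUniform X Q := by
  let ν : Measure (ι → ℝ) := Measure.infinitePi fun _ => ProbabilityTheory.cond volume (Set.Ioo (0 : ℝ) 1)
  have hup : Measurable (ULift.up : (ι → ℝ) → ULift.{w} (ι → ℝ)) := measurable_up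
  have hdown : Measurable (ULift.down : ULift.{w} (ι → ℝ) → ι → ℝ) := measurable_down
  have hX : ∀ k, Measurable fun ω : ULift.{w} (ι → ℝ) => ω.down k := fun k =>
    (measurable_pi_apply k).comp hdown
  have hQ : IsProbabilityMeasure (ν.map (ULift.up.{w})) :=
    Measure.isProbabilityMeasure_map hup.aemeasurable
  have hlaw : ∀ k, (ν.map (ULift.up.{w})).map (fun ω => ω.down k)
      = ProbabilityTheory.cond volume (Set.Ioo (0 : ℝ) 1) := fun k => by
    rw [Measure.map_map (hX k) hup]
    exact (measurePreserving_eval_infinitePi _ k).map_eq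
  refine ⟨ULift.{w} (ι → ℝ), inferInstance, ν.map ULift.up, fun k ω => ω.down k, hQ, hX, hlaw, ?_⟩
  rw [iIndepFun_iff_map_fun_eq_infinitePi_map hX]
  simp only [hlaw]
  rw [Measure.map_map hdown hup]
  exact Measure.map_id

theorem iIndepFun.indepFun_subtype_ne {ι Ω : Type*} [MeasurableSpace Ω] {P : Measure Ω}
    {Y : ι → Ω → ℝ} (h : iIndepFun Y P) (hY : ∀ k, Measurable (Y k)) (k : ι) :
    IndepFun (fun ω (d : {d // d ≠ k}) => Y d ω) (Y k) P := by
  have h1 := indep_iSup_of_disjoint (fun d => (hY d).comap_le) h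
    (disjoint_compl_left : Disjoint {k}ᶜ {k})
  refine indep_of_indep_of_le_left (indep_of_indep_of_le_right h1 (by simp)) ?_
  rw [← measurable_iff_comap_le]
  refine measurable_pi_of_forall fun d => ?_
  exact (comap_measurable (Y d)).mono
    (le_iSup₂ (f := fun e (_ : e ∈ ({k}ᶜ : Set ι)) => MeasurableSpace.comap (Y e) inferInstance)
      d.1 d.2) le_rfl

/-- The array `g₂ ((A, B i), lam i j)`, where `A = g₀ α` and `B i = g₁ (A, β i)`, has the
finite-dimensional laws of the two-level mixture with ingredients `μ`, `κ`, `η`: each variable is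
conditioned on all the uniform variables except the one that drives it. -/
theorem measure_biInter_model {Ω E F S : Type*} [MeasurableSpace Ω] [MeasurableSpace E]
    [MeasurableSpace F] [MeasurableSpace S] {Q : Measure Ω} [IsProbabilityMeasure Q]
    {α : Ω → ℝ} {β : ℕ → Ω → ℝ} {lam : ℕ → ℕ → Ω → ℝ} (h : IsIIDUniform (collect α β lam) Q)
    {μ : Measure E} {κ : Kernel E F} [IsMarkovKernel κ] {η : Kernel (E × F) S} [IsMarkovKernel η]
    {g₀ : ℝ → E} {g₁ : E × ℝ → F} {g₂ : (E × F) × ℝ → S} (hg₀ : Measurable g₀)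
    (hg₁ : Measurable g₁) (hg₂ : Measurable g₂)
    (hμ : (ProbabilityTheory.cond volume (Set.Ioo (0 : ℝ) 1)).map g₀ = μ)
    (hκ : ∀ a, (ProbabilityTheory.cond volume (Set.Ioo (0 : ℝ) 1)).map (fun r => g₁ (a, r)) = κ a)
    (hη : ∀ e, (ProbabilityTheory.cond volume (Set.Ioo (0 : ℝ) 1)).map (fun r => g₂ (e, r)) = η e)
    (I : Finset (ℕ × ℕ)) {C : ℕ × ℕ → Set S} (hC : ∀ c, MeasurableSet (C c)) :
    Q (⋂ c ∈ I, (fun ω => g₂ ((g₀ (α ω), g₁ (g₀ (α ω), β c.1 ω)), lam c.1 c.2 ω)) ⁻¹' C c) =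
      ∫⁻ a, ∏ i ∈ I.image Prod.fst, ∫⁻ b, ∏ c ∈ I with c.1 = i, η (a, b) (C c) ∂κ a ∂μ := by
  obtain ⟨hm, hlaw, hind⟩ := h
  let Z : ∀ k, Ω → {d // d ≠ k} → ℝ := fun k ω d => collect α β lam d.1 ω
  have hZ : ∀ k, Measurable (Z k) := fun k => measurable_pi_lambda _ fun d => hm d
  have hZm : ∀ k d, d ≠ k →
      Measurable[MeasurableSpace.comap (Z k) inferInstance] (collect α β lam d) := fun k d hd =>
    (measurable_pi_apply (⟨d, hd⟩ : {d // d ≠ k})).comp (comap_measurable (Z k))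
  have hZind := iIndepFun.indepFun_subtype_ne hind hm
  have hA : ∀ k, k ≠ Sum.inl () →
      Measurable[MeasurableSpace.comap (Z k) inferInstance] fun ω => g₀ (α ω) := fun k hk =>
    hg₀.comp (hZm k (Sum.inl ()) hk.symm)
  have hB : ∀ k i, k ≠ Sum.inl () → k ≠ Sum.inr (Sum.inl i) →
      Measurable[MeasurableSpace.comap (Z k) inferInstance] fun ω => g₁ (g₀ (α ω), β i ω) :=
    fun k i hk hk' => hg₁.comp ((hA k hk).prodMk (hZm k (Sum.inr (Sum.inl i)) hk'.symm))
  have hX : ∀ k (c : ℕ × ℕ), k ≠ Sum.inl () → k ≠ Sum.inr (Sum.inl c.1) →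
      k ≠ Sum.inr (Sum.inr c) → Measurable[MeasurableSpace.comap (Z k) inferInstance]
        fun ω => g₂ ((g₀ (α ω), g₁ (g₀ (α ω), β c.1 ω)), lam c.1 c.2 ω) := fun k c hk hk' hk'' =>
    hg₂.comp (((hA k hk).prodMk (hB k _ hk hk')).prodMk (hZm k (Sum.inr (Sum.inr c)) hk''.symm))
  have hα : Measurable α := hm (Sum.inl ())
  have hβ : ∀ i, Measurable (β i) := fun i => hm (Sum.inr (Sum.inl i))
  have hlam : ∀ c : ℕ × ℕ, Measurable (lam c.1 c.2) := fun c => hm (Sum.inr (Sum.inr c))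
  have hBlaw : ∀ i, HasCondLaw Q (MeasurableSpace.comap (Z (Sum.inr (Sum.inl i))) inferInstance)
      (fun ω => g₁ (g₀ (α ω), β i ω)) (fun ω => g₀ (α ω)) κ := fun i =>
    hasCondLaw_of_indepFun (hZ _) (hβ i) (hZind (Sum.inr (Sum.inl i))) (hA _ (by simp)) hg₁
      fun e => by rw [show Q.map (β i) = _ from hlaw (Sum.inr (Sum.inl i)), hκ]
  have hXlaw : ∀ c : ℕ × ℕ,
      HasCondLaw Q (MeasurableSpace.comap (Z (Sum.inr (Sum.inr c))) inferInstance)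
      (fun ω => g₂ ((g₀ (α ω), g₁ (g₀ (α ω), β c.1 ω)), lam c.1 c.2 ω))
      (fun ω => (g₀ (α ω), g₁ (g₀ (α ω), β c.1 ω))) η := fun c =>
    hasCondLaw_of_indepFun (hZ _) (hlam c) (hZind (Sum.inr (Sum.inr c)))
      ((hA _ (by simp)).prodMk (hB _ _ (by simp) (by simp))) hg₂
      fun e => by rw [show Q.map (lam c.1 c.2) = _ from hlaw (Sum.inr (Sum.inr c)), hη]
  have hmap : Q.map (fun ω => g₀ (α ω)) = μ := by
    rw [← hμ, ← show Q.map α = _ from hlaw (Sum.inl ()), Measure.map_map hg₀ hα]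
    rfl
  rw [← hmap]
  exact measure_biInter_eq_lintegral (hg₀.comp hα)
    (fun c => hg₂.comp (((hg₀.comp hα).prodMk (hg₁.comp ((hg₀.comp hα).prodMk (hβ _)))).prodMk
      (hlam c)))
    hBlaw (fun i i' hi => hB _ _ (by simp) (by simpa using hi.symm)) (fun i => hA _ (by simp))
    hXlaw (fun c d hd => hX _ _ (by simp) (by simp) (by simpa using hd.symm))
    (fun c d => (hA _ (by simp)).prodMk (hB _ _ (by simp) (by simp))) I hC

/-- The permutation of the cells comes from an injection of the index set of the i.i.d. family. -/
theorem IsIIDUniform.rowExchangeable {Ω S : Type*} [MeasurableSpace Ω] [MeasurableSpace S]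
    {Q : Measure Ω} [IsProbabilityMeasure Q] {α : Ω → ℝ} {β : ℕ → Ω → ℝ} {lam : ℕ → ℕ → Ω → ℝ}
    (h : IsIIDUniform (collect α β lam) Q) {f : ℝ × ℝ × ℝ → S} (hf : Measurable f) :
    RowExchangeable (fun i j ω => f (α ω, β i ω, lam i j ω)) Q := by
  intro σ τ _ _ I
  obtain ⟨hm, hlaw, hind⟩ := h
  let π : Unit ⊕ ℕ ⊕ (ℕ × ℕ) → Unit ⊕ ℕ ⊕ (ℕ × ℕ) :=
    Sum.map id (Sum.map σ fun c => (σ c.1, τ c.1 c.2))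
  have hπ : Function.Injective π := by
    refine Function.injective_id.sumMap (σ.injective.sumMap ?_)
    rintro ⟨a, b⟩ ⟨c, d⟩ hcd
    simp only [Prod.mk.injEq, EmbeddingLike.apply_eq_iff_eq] at hcd
    obtain ⟨rfl, hcd⟩ := hcd
    rw [(τ a).injective hcd]
  have hmap : Q.map (fun ω k => collect α β lam (π k) ω) = Q.map fun ω k => collect α β lam k ω := by
    rw [(hind.precomp hπ).map_fun_eq_infinitePi_map fun k => hm _,
      hind.map_fun_eq_infinitePi_map hm]
    congr 1
    funext k
    exact (hlaw _).trans (hlaw k).symm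
  have hid : IdentDistrib (fun ω k => collect α β lam (π k) ω) (fun ω k => collect α β lam k ω)
      Q Q :=
    ⟨(measurable_pi_lambda _ fun k => hm _).aemeasurable,
      (measurable_pi_lambda _ hm).aemeasurable, hmap⟩
  exact hid.comp (u := fun x (t : I) => f (x (Sum.inl ()), x (Sum.inr (Sum.inl t.1.1)),
    x (Sum.inr (Sum.inr t.1)))) (by fun_prop)

theorem SameFDD.rowExchangeable {Ω Ω' S : Type*} [MeasurableSpace Ω] [MeasurableSpace Ω']
    [MeasurableSpace S] {P : Measure Ω} {Q : Measure Ω'} {ξ : ℕ → ℕ → Ω → S} {ζ : ℕ → ℕ → Ω' → S}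
    (h : SameFDD (fun p : ℕ × ℕ => ζ p.1 p.2) Q (fun p : ℕ × ℕ => ξ p.1 p.2) P)
    (hζ : RowExchangeable ζ Q) : RowExchangeable ξ P := by
  classical
  intro σ τ hσ hτ I
  let π : ℕ × ℕ → ℕ × ℕ := fun c => (σ c.1, τ c.1 c.2)
  have h1 := (h (I.image π)).comp
    (u := fun x (t : I) => x ⟨π t, Finset.mem_image_of_mem π t.2⟩) (by fun_prop)
  exact h1.symm.trans ((hζ σ τ hσ hτ I).trans (h I))

end Model

/-! ### The representation theorem -/

theorem theorem3p1 {Ω : Type u} [MeasurableSpace Ω] (P : Measure Ω) [IsProbabilityMeasure P]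
    {S : Type v} [TopologicalSpace S] [PolishSpace S] [MeasurableSpace S] [BorelSpace S]
    (ξ : ℕ → ℕ → Ω → S) (hξ : ∀ i j, Measurable (ξ i j)) :
    RowExchangeable ξ P ↔
      ∃ (f : ℝ × ℝ × ℝ → S) (Ω' : Type w) (_ : MeasurableSpace Ω') (Q : Measure Ω')
        (α : Ω' → ℝ) (β : ℕ → Ω' → ℝ) (lam : ℕ → ℕ → Ω' → ℝ),
        Measurable f ∧ IsProbabilityMeasure Q ∧ IsIIDUniform (collect α β lam) Q ∧
          SameFDD (fun (p : ℕ × ℕ) ω => f (α ω, β p.1 ω, lam p.1 p.2 ω)) Q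
            (fun p : ℕ × ℕ => ξ p.1 p.2) P := by
  constructor
  · intro h
    obtain ⟨ω₀⟩ : Nonempty Ω := P.nonempty_of_neZero
    have : Nonempty S := ⟨ξ 0 0 ω₀⟩
    obtain ⟨μ, κ, η, _, _, _, hlaw⟩ := h.exists_kernel hξ
    obtain ⟨g₀, hg₀, hμ⟩ := exists_measurable_map_cond_Ioo_eq (Kernel.const Unit μ)
    obtain ⟨g₁, hg₁, hκ⟩ := exists_measurable_map_cond_Ioo_eq κ
    obtain ⟨g₂, hg₂, hη⟩ := exists_measurable_map_cond_Ioo_eq η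
    obtain ⟨Ω', _, Q, X, hQ, hX⟩ := exists_isIIDUniform.{w} (Unit ⊕ ℕ ⊕ (ℕ × ℕ))
    let α := X (Sum.inl ())
    let β := fun i => X (Sum.inr (Sum.inl i))
    let lam := fun i j => X (Sum.inr (Sum.inr (i, j)))
    have hcollect : collect α β lam = X := by
      funext k
      rcases k with _ | _ | _ <;> rfl
    let f : ℝ × ℝ × ℝ → S := fun r => g₂ ((g₀ ((), r.1), g₁ (g₀ ((), r.1), r.2.1)), r.2.2)
    have hf : Measurable f := by fun_prop
    rw [← hcollect] at hX
    refine ⟨f, Ω', inferInstance, Q, α, β, lam, hf, hQ, hX, ?_⟩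
    refine sameFDD_of_measure_biInter_eq (fun c => hf.comp ((hX.1 (Sum.inl ())).prodMk
      ((hX.1 (Sum.inr (Sum.inl c.1))).prodMk (hX.1 (Sum.inr (Sum.inr c))))))
      (fun c => hξ _ _) fun I C hC => ?_
    rw [hlaw I C hC]
    exact measure_biInter_model hX (hg₀.comp (measurable_const.prodMk measurable_id)) hg₁ hg₂
      (hμ ()) hκ hη I hC
  · rintro ⟨f, Ω', _, Q, α, β, lam, hf, _, hU, h⟩
    exact SameFDD.rowExchangeable (ζ := fun i j ω => f (α ω, β i ω, lam i j ω)) h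
      (hU.rowExchangeable hf)
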